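/- **Theorem.** Call a Turing degree a *c.e. degree* if it is the Turing degree of some computably enumerable (c.e.) set of natural numbers, and let $\mathbf{0}'$ be the Turing degree of the halting set. For $A, B \subseteq \mathbb{N}$, a *separator* of $A$ and $B$ is a set $Z \subseteq \mathbb{N}$ with $A \subseteq Z$ and $Z \cap B = \emptyset$. Then for every c.e. degree $\mathbf{c}$ there are c.e. sets $A, B \subseteq \mathbb{N}$ with $A \cap B = \emptyset$ and $\mathbb{N} \setminus (A \cup B)$ infinite such that $$\{\mathbf{w} : \mathbf{w} \text{ is a c.e. degree and } \mathbf{w} = \deg_T(Z) \text{ for some separator } Z \text{ of } A \text{ and } B\} = \{\mathbf{c}, \mathbf{0}'\}.$$ Moreover $A$ and $B$ can be chosen so that $\deg_T(A) = \mathbf{0}'$ and $\deg_T(\mathbb{N} \setminus B) = \mathbf{c}$. -/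

import Mathlib

namespace SeparatingSpectra

/-- A set of natural numbers is computably enumerable. -/
def IsCE (X : Set ℕ) : Prop := REPred fun n : ℕ => n ∈ X

open Classical in
/-- The (total) characteristic function of `X`, as an oracle. -/
noncomputable def charFun (X : Set ℕ) : ℕ →. ℕ :=
  fun n => Part.some (if n ∈ X then 1 else 0)

/-- The Turing degree of a set of natural numbers. -/
noncomputable def deg (X : Set ℕ) : TuringDegree :=
  toAntisymmetrization TuringReducible (charFun X)

/-- A c.e. degree: the Turing degree of some c.e. set. -/
def IsCEDegree (w : TuringDegree) : Prop := ∃ W : Set ℕ, IsCE W ∧ deg W = w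

/-- The diagonal halting set `K = {e | φ_e(e)↓}`. -/
def haltingSet : Set ℕ := {e | ((Denumerable.ofNat Nat.Partrec.Code e).eval e).Dom}

/-- The degree `0'` of the halting set. -/
noncomputable def zeroJump : TuringDegree := deg haltingSet

/-- The separating class `S(A, B) = {Z | A ⊆ Z, Z ∩ B = ∅}`. -/
def separatingClass (A B : Set ℕ) : Set (Set ℕ) := {Z | A ⊆ Z ∧ Z ∩ B = ∅}

/-- The c.e. degrees realized in a class of sets of natural numbers. -/
def spectrum (P : Set (Set ℕ)) : Set TuringDegree := {w | IsCEDegree w ∧ ∃ Z ∈ P, deg Z = w}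

end SeparatingSpectra

/-!
Column `c` consists of the numbers `Nat.pair c j`. Let `C` be c.e. with infinite complement, of the
given degree. The set `A` contains all but finitely many elements of every column, and `B` is the
part outside `A` of the columns with index in `C`. Until `c` has entered `C`, whenever some `k ≤ c`
enters the halting set or `c` enters `C`, elements of column `c` are dumped into `A`: for each pair
of a functional and a c.e. oracle coded by a number `≤ c`, one element which the separator computed
by that pair currently seems to omit. There are at most `c + 2` such events, so a column of which
`(c + 1) * (c + 2) + 1` elements start outside `A` retains one of them, and `B` computes `C`.

Let `Z` be a separator of c.e. degree. If `Z` omits only finitely many numbers outside `B`, then `Z`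
is almost equal to the complement of `B`, whose degree is that of `C`. Otherwise infinitely many
columns with index `c ∉ C` contain a number outside `Z`. Let `W` be a c.e. set of the degree of `Z`.
Then `Z` can compute a stage after which the approximations to `Z` from `W` are correct on column
`c`. A later event would dump a number that really lies outside `Z`, although `A ⊆ Z`. So there is
no later event, and `Z` decides the halting problem up to `c`.
-/

namespace SeparatingSpectra

open Nat.Partrec (Code)
open Nat.Partrec.Code (eval evaln)
open Encodable Denumerable Filter

attribute [local fun_prop] Primrec Primrec.id Primrec.const Primrec.comp Primrec.pair Primrec.fst
  Primrec.snd Primrec.unpair Primrec.encode Primrec.ofNat Primrec.list_range Primrec.succ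

section Primrec

variable {α β : Type*} [Primcodable α] [Primcodable β]

@[fun_prop]
theorem primrec_natPair {f g : α → ℕ} (hf : Primrec f) (hg : Primrec g) :
    Primrec fun a => Nat.pair (f a) (g a) :=
  Primrec₂.natPair.comp hf hg

@[fun_prop]
theorem primrec_add {f g : α → ℕ} (hf : Primrec f) (hg : Primrec g) :
    Primrec fun a => f a + g a :=
  Primrec.nat_add.comp hf hg

@[fun_prop]
theorem primrec_evaln {s x : α → ℕ} {d : α → Code} (hs : Primrec s) (hd : Primrec d)
    (hx : Primrec x) : Primrec fun a => evaln (s a) (d a) (x a) :=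
  Code.primrec_evaln.comp ((hs.pair hd).pair hx)

@[fun_prop]
theorem primrec_findSome? {l : α → List β} {γ : Type*} [Primcodable γ] {f : α → β → Option γ}
    (hl : Primrec l) (hf : Primrec fun p : α × β => f p.1 p.2) :
    Primrec fun a => (l a).findSome? (f a) :=
  (Primrec.list_head?.comp (Primrec.listFilterMap hl hf)).of_eq fun _ => List.head?_filterMap

theorem primrec_find? {l : α → List β} {p : α → β → Prop} [∀ a b, Decidable (p a b)]
    (hl : Primrec l) (hp : PrimrecPred fun x : α × β => p x.1 x.2) :
    Primrec fun a => (l a).find? (p a ·) := by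
  simp only [List.find?_eq_findSome?_guard]
  exact primrec_findSome? hl ((Primrec.ite hp (Primrec.option_some.comp .snd)
    (.const none)).of_eq fun x => by simp [Option.guard])

theorem primrecPred_mem_list {l : α → List β} {b : α → β} (hl : Primrec l) (hb : Primrec b) :
    PrimrecPred fun a => b a ∈ l a :=
  (Primrec.eq.exists_mem_list.comp hl hb).of_eq fun _ => by simp

end Primrec

section Oracle

variable {α β γ : Type*} [Primcodable α] [Primcodable β] [Primcodable γ] {O : Set (ℕ →. ℕ)}

theorem computableIn_comp {f : β → γ} {g : α → β} (hf : ComputableIn O f)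
    (hg : ComputableIn O g) : ComputableIn O fun a => f (g a) :=
  (Nat.RecursiveIn.comp hf hg).of_eq fun n => by cases decode (α := α) n <;> simp

theorem computableIn_pair {f : α → β} {g : α → γ} (hf : ComputableIn O f)
    (hg : ComputableIn O g) : ComputableIn O fun a => (f a, g a) :=
  (Nat.RecursiveIn.pair hf hg).of_eq fun n => by cases decode (α := α) n <;> simp [Seq.seq]

theorem computableIn_oracle {g : ℕ → ℕ} (hg : (g : ℕ →. ℕ) ∈ O) : ComputableIn O g :=
  RecursiveIn.iff_nat.2 (.oracle _ hg)

/-- `p` is decidable with the help of the oracles in `O`: the relative form of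
`ComputablePred`. -/
def ComputablePredIn (O : Set (ℕ →. ℕ)) (p : α → Prop) : Prop :=
  ∃ _ : DecidablePred p, ComputableIn O fun a => decide (p a)

namespace ComputablePredIn

variable {p q : α → Prop}

theorem of_primrecPred (hp : PrimrecPred p) : ComputablePredIn O p :=
  let ⟨_, h⟩ := hp
  ⟨_, h.computableIn⟩

theorem of_iff (hp : ComputablePredIn O p) (h : ∀ a, p a ↔ q a) : ComputablePredIn O q :=
  (funext fun a => propext (h a) : p = q) ▸ hp

theorem decide [DecidablePred p] (hp : ComputablePredIn O p) :
    ComputableIn O fun a => decide (p a) := by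
  obtain ⟨_, h⟩ := hp
  convert h

theorem comp {p : β → Prop} {f : α → β} (hp : ComputablePredIn O p) (hf : ComputableIn O f) :
    ComputablePredIn O fun a => p (f a) :=
  let ⟨_, h⟩ := hp
  ⟨fun _ => inferInstance, computableIn_comp h hf⟩

theorem not (hp : ComputablePredIn O p) : ComputablePredIn O fun a => ¬ p a := by
  obtain ⟨_, h⟩ := hp
  refine ⟨fun _ => inferInstance, ?_⟩
  simpa only [decide_not] using computableIn_comp Primrec.not.computableIn h

theorem and (hp : ComputablePredIn O p) (hq : ComputablePredIn O q) :
    ComputablePredIn O fun a => p a ∧ q a := by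
  obtain ⟨_, hp⟩ := hp
  obtain ⟨_, hq⟩ := hq
  refine ⟨fun _ => inferInstance, ?_⟩
  simpa only [Bool.decide_and] using
    computableIn_comp (Primrec₂.computableIn₂ Primrec.and) (computableIn_pair hp hq)

theorem imp (hp : ComputablePredIn O p) (hq : ComputablePredIn O q) :
    ComputablePredIn O fun a => p a → q a := by
  simpa only [not_and, not_not] using (hp.and hq.not).not

theorem find {p : α → ℕ → Prop} [∀ a, DecidablePred (p a)]
    (hp : ComputablePredIn O fun x : α × ℕ => p x.1 x.2) (h : ∀ a, ∃ n, p a n) :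
    ComputableIn O fun a => Nat.find (h a) := by
  have test : ComputableIn O fun x : α × ℕ => if p x.1 x.2 then 0 else 1 :=
    (computableIn_comp (Primrec.cond Primrec.id (.const 0) (.const 1)).computableIn
      hp.decide).of_eq fun x => by by_cases hx : p x.1 x.2 <;> simp [hx]
  refine (Nat.RecursiveIn.rfind test).of_eq fun n => ?_
  cases ha : decode (α := α) n with
  | none =>
    simp only [Part.coe_none, Part.bind_none]
    refine Part.eq_none_iff.2 fun m hm => ?_
    obtain ⟨hm, -⟩ := Nat.mem_rfind.1 hm
    simp [ha] at hm
  | some a =>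
    simp only [Part.coe_some, Part.bind_some, Part.map_some, encode_nat]
    exact Part.eq_some_iff.2 (Nat.mem_rfind.2
      ⟨by simpa [ha] using Nat.find_spec (h a), fun hm => by simpa [ha] using Nat.find_min _ hm⟩)

theorem forall_lt {p : α → ℕ → Prop} {b : α → ℕ}
    (hp : ComputablePredIn O fun x : α × ℕ => p x.1 x.2) (hb : ComputableIn O b) :
    ComputablePredIn O fun a => ∀ n < b a, p a n := by
  classical
  have hlt : ComputablePredIn O fun x : α × ℕ => x.2 < b x.1 :=
    (of_primrecPred Primrec.nat_lt).comp
      (computableIn_pair .snd (computableIn_comp hb .fst))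
  have hfail : ∀ a, ∃ n, ¬ (n < b a ∧ p a n) := fun a => ⟨b a, fun h => h.1.false⟩
  have hle : ComputablePredIn O fun a => b a ≤ Nat.find (hfail a) :=
    (of_primrecPred Primrec.nat_le).comp (computableIn_pair hb
      (find (p := fun a n => ¬ (n < b a ∧ p a n)) (hlt.and hp).not hfail))
  refine hle.of_iff fun a => ?_
  simp only [Nat.le_find_iff, not_not]
  exact forall₂_congr fun n hn => and_iff_right hn

theorem exists_lt {p : α → ℕ → Prop} {b : α → ℕ}
    (hp : ComputablePredIn O fun x : α × ℕ => p x.1 x.2) (hb : ComputableIn O b) :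
    ComputablePredIn O fun a => ∃ n < b a, p a n := by
  simpa only [not_forall, not_not, exists_prop] using
    (forall_lt (p := fun a n => ¬ p a n) hp.not hb).not

end ComputablePredIn

end Oracle

section TuringReducibility

variable {X Y : Set ℕ}

theorem charFun_eq_indicator (X : Set ℕ) : charFun X = (X.indicator 1 : ℕ → ℕ) := by
  ext n
  by_cases hn : n ∈ X <;> simp [charFun, hn]

theorem computablePredIn_mem (X : Set ℕ) : ComputablePredIn {charFun X} (· ∈ X) := by
  have h : ComputableIn {charFun X} (X.indicator 1 : ℕ → ℕ) :=
    computableIn_oracle (charFun_eq_indicator X).symm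
  have hone : PrimrecPred fun n : ℕ => n = 1 := Primrec.eq.comp Primrec.id (Primrec.const 1)
  refine ((ComputablePredIn.of_primrecPred hone).comp h).of_iff fun n => ?_
  by_cases hn : n ∈ X <;> simp [hn]

theorem turingReducible_charFun_iff :
    TuringReducible (charFun X) (charFun Y) ↔ ComputablePredIn {charFun Y} (· ∈ X) := by
  classical
  refine ⟨fun h => ?_, fun h => ?_⟩
  · obtain ⟨_, hX⟩ := computablePredIn_mem X
    exact ⟨_, RecursiveIn.subst hX (by rintro _ rfl; exact h)⟩
  · exact (computableIn_comp (Primrec.cond Primrec.id (.const 1) (.const 0)).computableIn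
      h.decide).of_eq fun n => by by_cases hn : n ∈ X <;> simp [charFun, hn]

theorem deg_le_deg_iff : deg X ≤ deg Y ↔ ComputablePredIn {charFun Y} (· ∈ X) :=
  turingReducible_charFun_iff

theorem deg_compl (X : Set ℕ) : deg Xᶜ = deg X :=
  le_antisymm (deg_le_deg_iff.2 (computablePredIn_mem X).not)
    (deg_le_deg_iff.2 ((computablePredIn_mem Xᶜ).not.of_iff fun _ => not_not))

theorem deg_le_deg_of_finite_symmDiff (h : (symmDiff X Y).Finite) : deg X ≤ deg Y := by
  have hF : ComputablePredIn {charFun Y} (· ∈ symmDiff X Y) :=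
    (ComputablePredIn.of_primrecPred
      (primrecPred_mem_list (.const h.toFinset.toList) .id)).of_iff fun n => by simp
  have hY := computablePredIn_mem Y
  refine deg_le_deg_iff.2 (((hF.imp hY.not).and (hF.not.imp hY)).of_iff fun n => ?_)
  simp only [Set.mem_symmDiff]
  tauto

theorem deg_eq_deg_of_finite_symmDiff (h : (symmDiff X Y).Finite) : deg X = deg Y :=
  le_antisymm (deg_le_deg_of_finite_symmDiff h)
    (deg_le_deg_of_finite_symmDiff (symmDiff_comm X Y ▸ h))

end TuringReducibility

section UsePrinciple

/-- The string of the first `n` values of `o`. -/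
def initSeg (o : ℕ → ℕ) (n : ℕ) : List ℕ := (List.range n).map o

theorem initSeg_prefix (o : ℕ → ℕ) {m n : ℕ} (h : m ≤ n) : initSeg o m <+: initSeg o n :=
  (List.prefix_iff_eq_take.2 (by simp [List.take_range, h])).map o

theorem initSeg_congr {o o' : ℕ → ℕ} {n : ℕ} (h : ∀ i < n, o i = o' i) :
    initSeg o n = initSeg o' n :=
  List.map_congr_left fun i hi => h i (List.mem_range.1 hi)

/-- `F` is a Turing functional, presented as a monotone partial recursive operation on finite
strings, which computes `f` from the oracle `o`. Where `f` diverges, `F` may still converge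
along `o`. -/
structure ComputesFrom (F : List ℕ → ℕ →. ℕ) (o : ℕ → ℕ) (f : ℕ →. ℕ) : Prop where
  partrec : Partrec₂ F
  mono {σ τ : List ℕ} {x y : ℕ} : σ <+: τ → y ∈ F σ x → y ∈ F τ x
  eventually_mem {x y : ℕ} : y ∈ f x → ∀ᶠ n in atTop, y ∈ F (initSeg o n) x

namespace ComputesFrom

variable {o : ℕ → ℕ} {f g : ℕ →. ℕ} {F G : List ℕ → ℕ →. ℕ}

theorem mono_map {β : Type*} {φ : ℕ → β} (hF : ComputesFrom F o f) {σ τ : List ℕ} {x : ℕ} {b : β}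
    (h : σ <+: τ) (hb : b ∈ (F σ x).map φ) : b ∈ (F τ x).map φ := by
  obtain ⟨a, ha, rfl⟩ := (Part.mem_map_iff _).1 hb
  exact Part.mem_map _ (hF.mono h ha)

theorem eventually_mem_map {β : Type*} {φ : ℕ → β} (hF : ComputesFrom F o f) {x : ℕ} {b : β}
    (hb : b ∈ (f x).map φ) : ∀ᶠ n in atTop, b ∈ (F (initSeg o n) x).map φ := by
  obtain ⟨a, ha, rfl⟩ := (Part.mem_map_iff _).1 hb
  exact (hF.eventually_mem ha).mono fun _ => Part.mem_map _

theorem of_partrec (hf : Nat.Partrec f) : ComputesFrom (fun _ => f) o f where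
  partrec := (Partrec.nat_iff.2 hf).comp Computable.snd
  mono _ h := h
  eventually_mem h := Eventually.of_forall fun _ => h

theorem oracle (o : ℕ → ℕ) : ComputesFrom (fun σ x => (σ[x]? : Option ℕ)) o o where
  partrec := Computable.ofOption Computable.list_getElem?
  mono h hy := by
    simp only [Part.mem_ofOption, Option.mem_def] at hy ⊢
    obtain ⟨hx, rfl⟩ := List.getElem?_eq_some_iff.1 hy
    exact List.prefix_iff_getElem?.1 h _ hx
  eventually_mem {x y} h := by
    filter_upwards [eventually_gt_atTop x] with n hn
    simpa [initSeg, hn] using h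

theorem pair (hF : ComputesFrom F o f) (hG : ComputesFrom G o g) :
    ComputesFrom (fun σ x => (F σ x).bind fun a => (G σ x).map (Nat.pair a)) o
      (fun x => (f x).bind fun a => (g x).map (Nat.pair a)) where
  partrec := hF.partrec.bind ((hG.partrec.comp (Computable.fst.comp .fst)
    (Computable.snd.comp .fst)).map (Primrec₂.natPair.to_comp.comp
      (Computable.snd.comp .fst) .snd).to₂).to₂
  mono h hy := by
    obtain ⟨a, ha, hy⟩ := Part.mem_bind_iff.1 hy
    exact Part.mem_bind (hF.mono h ha) (hG.mono_map h hy)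
  eventually_mem hy := by
    obtain ⟨a, ha, hy⟩ := Part.mem_bind_iff.1 hy
    filter_upwards [hF.eventually_mem ha, hG.eventually_mem_map hy] with n ha hy
    exact Part.mem_bind ha hy

theorem comp (hF : ComputesFrom F o f) (hG : ComputesFrom G o g) :
    ComputesFrom (fun σ x => (G σ x).bind (F σ)) o (fun x => (g x).bind f) where
  partrec := hG.partrec.bind (hF.partrec.comp (Computable.fst.comp .fst) .snd).to₂
  mono h hy := by
    obtain ⟨a, ha, hy⟩ := Part.mem_bind_iff.1 hy
    exact Part.mem_bind (hG.mono h ha) (hF.mono h hy)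
  eventually_mem hy := by
    obtain ⟨a, ha, hy⟩ := Part.mem_bind_iff.1 hy
    filter_upwards [hG.eventually_mem ha, hF.eventually_mem hy] with n ha hy
    exact Part.mem_bind ha hy

/-- Primitive recursion from the partial functions `f` and `g`, in the form in which it occurs
in `Nat.RecursiveIn`. -/
def primrecFrom (f g : ℕ →. ℕ) (x : ℕ) : Part ℕ :=
  Nat.rec (f x.unpair.1) (fun k r => r.bind fun i =>
    g (Nat.pair x.unpair.1 (Nat.pair k i))) x.unpair.2

theorem prec (hF : ComputesFrom F o f) (hG : ComputesFrom G o g) :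
    ComputesFrom (fun σ => primrecFrom (F σ) (G σ)) o (primrecFrom f g) where
  partrec := by
    refine Partrec.nat_rec (f := fun p : List ℕ × ℕ => p.2.unpair.2)
      (g := fun p => F p.1 p.2.unpair.1)
      (h := fun p r => G p.1 (Nat.pair p.2.unpair.1 (Nat.pair r.1 r.2))) ?_
      (hF.partrec.comp .fst ?_) (hG.partrec.comp (Computable.fst.comp .fst) ?_)
    all_goals exact Primrec.to_comp (by fun_prop)
  mono {σ τ x y} h := by
    unfold primrecFrom
    induction x.unpair.2 generalizing y with
    | zero => exact hF.mono h
    | succ k ih =>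
      intro hy
      obtain ⟨a, ha, hy⟩ := Part.mem_bind_iff.1 hy
      exact Part.mem_bind (ih ha) (hG.mono h hy)
  eventually_mem {x y} := by
    unfold primrecFrom
    induction x.unpair.2 generalizing y with
    | zero => exact hF.eventually_mem
    | succ k ih =>
      intro hy
      obtain ⟨a, ha, hy⟩ := Part.mem_bind_iff.1 hy
      filter_upwards [ih ha, hG.eventually_mem hy] with n ha hy
      exact Part.mem_bind ha hy

theorem rfind (hF : ComputesFrom F o f) :
    ComputesFrom (fun σ x => Nat.rfind fun k => (F σ (Nat.pair x k)).map (· = 0)) o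
      (fun x => Nat.rfind fun k => (f (Nat.pair x k)).map (· = 0)) where
  partrec := by
    refine Partrec.rfind ((hF.partrec.comp (Computable.fst.comp .fst) ?_).map ?_)
    · exact Primrec.to_comp (by fun_prop)
    · exact (Primrec.eq.decide.comp .snd (.const 0)).to_comp
  mono h hy := by
    obtain ⟨hy, hlt⟩ := Nat.mem_rfind.1 hy
    exact Nat.mem_rfind.2 ⟨hF.mono_map h hy, fun hm => hF.mono_map h (hlt hm)⟩
  eventually_mem {x y} hy := by
    obtain ⟨hy, hlt⟩ := Nat.mem_rfind.1 hy
    have hlt' : ∀ᶠ n in atTop, ∀ m ∈ Set.Iio y,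
        false ∈ (F (initSeg o n) (Nat.pair x m)).map fun a => decide (a = 0) :=
      (eventually_all_finite (Set.finite_Iio y)).2 fun m hm => hF.eventually_mem_map (hlt hm)
    filter_upwards [hF.eventually_mem_map hy, hlt'] with n hy hlt
    exact Nat.mem_rfind.2 ⟨hy, fun hm => hlt _ hm⟩

end ComputesFrom

theorem exists_computesFrom {o : ℕ → ℕ} {f : ℕ →. ℕ} (hf : Nat.RecursiveIn {(o : ℕ →. ℕ)} f) :
    ∃ F, ComputesFrom F o f := by
  induction hf with
  | zero => exact ⟨_, .of_partrec .zero⟩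
  | succ => exact ⟨_, .of_partrec .succ⟩
  | left => exact ⟨_, .of_partrec .left⟩
  | right => exact ⟨_, .of_partrec .right⟩
  | oracle g hg => exact Set.mem_singleton_iff.1 hg ▸ ⟨_, .oracle o⟩
  | pair _ _ ihf ihg =>
    obtain ⟨⟨F, hF⟩, G, hG⟩ := And.intro ihf ihg
    exact ⟨_, by simpa [Seq.seq] using hF.pair hG⟩
  | comp _ _ ihf ihg =>
    obtain ⟨⟨F, hF⟩, G, hG⟩ := And.intro ihf ihg
    exact ⟨_, hF.comp hG⟩
  | prec _ _ ihf ihg =>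
    obtain ⟨⟨F, hF⟩, G, hG⟩ := And.intro ihf ihg
    exact ⟨_, hF.prec hG⟩
  | rfind _ ihf =>
    obtain ⟨F, hF⟩ := ihf
    exact ⟨_, hF.rfind⟩

theorem exists_code_computesFrom {o : ℕ → ℕ} {f : ℕ →. ℕ} (hf : TuringReducible f o) :
    ∃ q : Code, ComputesFrom (fun σ x => eval q (Nat.pair (encode σ) x)) o f := by
  obtain ⟨F, hF⟩ := exists_computesFrom (RecursiveIn.iff_nat.1 hf)
  obtain ⟨q, hq⟩ := Code.exists_code.1 (Partrec.nat_iff.1 (hF.partrec.comp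
    (g := fun p : ℕ => ofNat (List ℕ) p.unpair.1) (h := fun p => p.unpair.2)
    (Primrec.to_comp (by fun_prop)) (Primrec.to_comp (by fun_prop))))
  exact ⟨q, by simpa [hq] using hF⟩

end UsePrinciple

section Stages

/-- The computably enumerable set with index `d`. -/
def ceSet (d : Code) : Set ℕ := {i | (eval d i).Dom}

/-- The finite part of `ceSet d` enumerated by stage `s`. -/
def ceStage (d : Code) (s : ℕ) : Set ℕ := {i | (evaln s d i).isSome}

variable {d : Code} {i : ℕ}

theorem ceStage_mono (d : Code) : Monotone (ceStage d) := fun s t hst i hi => by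
  obtain ⟨y, hy⟩ := Option.isSome_iff_exists.1 hi
  exact Option.isSome_iff_exists.2 ⟨y, Code.evaln_mono hst hy⟩

theorem mem_ceSet_iff : i ∈ ceSet d ↔ ∃ s, i ∈ ceStage d s := by
  simp only [ceSet, ceStage, Set.mem_ofPred_eq, Part.dom_iff_mem, Option.isSome_iff_exists]
  exact ⟨fun ⟨y, hy⟩ => (Code.evaln_complete.1 hy).imp fun _ h => ⟨y, h⟩,
    fun ⟨_, y, hy⟩ => ⟨y, Code.evaln_sound hy⟩⟩

theorem ceStage_subset (d : Code) (s : ℕ) : ceStage d s ⊆ ceSet d :=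
  fun _ h => mem_ceSet_iff.2 ⟨s, h⟩

theorem eventually_mem_ceStage (h : i ∈ ceSet d) : ∀ᶠ s in atTop, i ∈ ceStage d s := by
  obtain ⟨t, ht⟩ := mem_ceSet_iff.1 h
  filter_upwards [eventually_ge_atTop t] with s hs using ceStage_mono d hs ht

theorem primrecPred_mem_ceStage {α : Type*} [Primcodable α] {d : α → Code} {s i : α → ℕ}
    (hd : Primrec d) (hs : Primrec s) (hi : Primrec i) :
    PrimrecPred fun a => i a ∈ ceStage (d a) (s a) :=
  Primrec.eq.comp (Primrec.option_isSome.comp (primrec_evaln hs hd hi)) (.const true)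

theorem IsCE.exists_ceSet_eq {X : Set ℕ} (hX : IsCE X) : ∃ d, ceSet d = X := by
  obtain ⟨d, hd⟩ := Code.exists_code.1 (Partrec.nat_iff.1 (hX.map (Computable.const 0).to₂))
  exact ⟨d, Set.ext fun i => by simp [ceSet, hd, Part.assert]⟩

theorem isCE_of_primrecPred {R : ℕ → ℕ → Prop} (hR : PrimrecPred fun p : ℕ × ℕ => R p.1 p.2) :
    IsCE {x | ∃ s, R x s} := by
  classical
  have h : Partrec fun x => Nat.rfind fun s => Part.some (decide (R x s)) :=
    Partrec.rfind (p := fun x s => Part.some (decide (R x s))) hR.decide.to_comp.partrec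
  exact h.dom_re.of_eq fun x => Nat.rfind_dom.trans (by simp)

end Stages

section Guess

variable {d q : Code} {f : ℕ → ℕ} {x s t : ℕ}

/-- The stage-`s` approximation to the string of the first `n` bits of `ceSet d`. -/
noncomputable def stageSeg (d : Code) (s n : ℕ) : List ℕ := initSeg ((ceStage d s).indicator 1) n

@[fun_prop]
theorem primrec_stageSeg {α : Type*} [Primcodable α] {d : α → Code} {s n : α → ℕ}
    (hd : Primrec d) (hs : Primrec s) (hn : Primrec n) :
    Primrec fun a => stageSeg (d a) (s a) (n a) := by
  classical
  refine Primrec.list_map (Primrec.list_range.comp hn) ((Primrec.ite (primrecPred_mem_ceStage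
    (hd.comp .fst) (hs.comp .fst) .snd) (.const 1) (.const 0)).of_eq fun p => ?_)
  simp [Set.indicator_apply]

/-- The stage-`s` value at `x` of the functional `q` with oracle `ceSet d`. -/
noncomputable def guess (q d : Code) (x s : ℕ) : Option ℕ :=
  (List.range (s + 1)).findSome? fun n => evaln s q (Nat.pair (encode (stageSeg d s n)) x)

@[fun_prop]
theorem primrec_guess {α : Type*} [Primcodable α] {q d : α → Code} {x s : α → ℕ}
    (hq : Primrec q) (hd : Primrec d) (hx : Primrec x) (hs : Primrec s) :
    Primrec fun a => guess (q a) (d a) (x a) (s a) := by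
  unfold guess
  fun_prop

/-- By stage `s` the functional `q` has converged at `x` on an initial segment of `ceSet d` whose
enumeration is complete. -/
def Settled (q d : Code) (x s : ℕ) : Prop :=
  ∃ n < s + 1, (∀ i < n, i ∈ ceSet d → i ∈ ceStage d s) ∧
    (evaln s q (Nat.pair (encode (stageSeg d s n)) x)).isSome

theorem stageSeg_eq_initSeg {n : ℕ} (h : ∀ i < n, i ∈ ceSet d → i ∈ ceStage d s) :
    stageSeg d s n = initSeg ((ceSet d).indicator 1) n :=
  initSeg_congr fun i hi => by
    classical
    simp only [Set.indicator_apply, (⟨h i hi, fun h => ceStage_subset d s h⟩ : _ ↔ _)]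

theorem Settled.mono (hst : s ≤ t) (h : Settled q d x s) : Settled q d x t := by
  obtain ⟨n, hn, hC, hq⟩ := h
  have hC' : ∀ i < n, i ∈ ceSet d → i ∈ ceStage d t :=
    fun i hi hd => ceStage_mono d hst (hC i hi hd)
  refine ⟨n, by lia, hC', ?_⟩
  rw [stageSeg_eq_initSeg hC', ← stageSeg_eq_initSeg hC]
  obtain ⟨y, hy⟩ := Option.isSome_iff_exists.1 hq
  exact Option.isSome_iff_exists.2 ⟨y, Code.evaln_mono hst hy⟩

theorem exists_settled
    (hq : ComputesFrom (fun σ x => eval q (Nat.pair (encode σ) x)) ((ceSet d).indicator 1) f)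
    (x : ℕ) : ∃ s, Settled q d x s := by
  obtain ⟨n, hn⟩ := (hq.eventually_mem (Part.mem_some (f x))).exists
  obtain ⟨k, hk⟩ := Code.evaln_complete.1 hn
  have hC : ∀ᶠ s in atTop, ∀ i ∈ Set.Iio n, i ∈ ceSet d → i ∈ ceStage d s :=
    (eventually_all_finite (Set.finite_Iio n)).2 fun i _ =>
      eventually_imp_distrib_left.2 eventually_mem_ceStage
  obtain ⟨s, hC, hks, hns⟩ := (hC.and ((eventually_ge_atTop k).and (eventually_ge_atTop n))).exists
  refine ⟨s, n, by lia, hC, Option.isSome_iff_exists.2 ⟨f x, ?_⟩⟩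
  rw [stageSeg_eq_initSeg hC]
  exact Code.evaln_mono hks hk

theorem Settled.guess_eq
    (hq : ComputesFrom (fun σ x => eval q (Nat.pair (encode σ) x)) ((ceSet d).indicator 1) f)
    (h : Settled q d x s) : guess q d x s = some (f x) := by
  obtain ⟨n, hn, hC, hz⟩ := h
  have consistent {m n y z : ℕ} (hmn : m ≤ n)
      (hy : y ∈ evaln s q (Nat.pair (encode (stageSeg d s m)) x))
      (hz : z ∈ evaln s q (Nat.pair (encode (stageSeg d s n)) x)) : y = z :=
    Part.mem_unique (hq.mono (initSeg_prefix _ hmn) (Code.evaln_sound hy)) (Code.evaln_sound hz)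
  obtain ⟨z, hz⟩ := Option.isSome_iff_exists.1 hz
  have hzf : z = f x := by
    obtain ⟨k, hk, hnk⟩ := ((hq.eventually_mem (Part.mem_some (f x))).and
      (eventually_ge_atTop n)).exists
    have hz' := Code.evaln_sound hz
    rw [stageSeg_eq_initSeg hC] at hz'
    exact Part.mem_unique (hq.mono (initSeg_prefix _ hnk) hz') hk
  have hsome : (guess q d x s).isSome :=
    List.findSome?_isSome_iff.2 ⟨n, List.mem_range.2 hn, by simp [hz]⟩
  obtain ⟨y, hy⟩ := Option.isSome_iff_exists.1 hsome
  obtain ⟨m, -, hm⟩ := List.exists_of_findSome?_eq_some hy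
  rw [hy, ← hzf]
  exact congrArg some ((le_total m n).elim (consistent · hm hz) (consistent · hz hm |>.symm))

theorem computablePredIn_settled (q d : Code) :
    ComputablePredIn {charFun (ceSet d)} fun p : ℕ × ℕ => Settled q d p.1 p.2 := by
  have hC : ComputablePredIn {charFun (ceSet d)} fun p : ((ℕ × ℕ) × ℕ) × ℕ =>
      p.2 ∈ ceSet d → p.2 ∈ ceStage d p.1.1.2 :=
    ((computablePredIn_mem _).comp .snd).imp
      (.of_primrecPred (primrecPred_mem_ceStage (by fun_prop) (by fun_prop) (by fun_prop)))
  have hq : ComputablePredIn {charFun (ceSet d)} fun p : (ℕ × ℕ) × ℕ =>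
      (evaln p.1.2 q (Nat.pair (encode (stageSeg d p.1.2 p.2)) p.1.1)).isSome :=
    .of_primrecPred (Primrec.eq.comp (Primrec.option_isSome.comp (by fun_prop)) (.const true))
  exact ComputablePredIn.exists_lt ((ComputablePredIn.forall_lt hC .snd).and hq)
    (Primrec.computableIn (by fun_prop))

theorem exists_modulus (hf : TuringReducible f ((ceSet d).indicator 1 : ℕ → ℕ)) {u : ℕ → ℕ}
    (hu : Computable u) : ∃ q M, ComputableIn {charFun (ceSet d)} M ∧
      ∀ c, ∀ s ≥ M c, ∀ x < u c, guess q d x s = some (f x) := by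
  classical
  obtain ⟨q, hq⟩ := exists_code_computesFrom hf
  have hex (c : ℕ) : ∃ s, ∀ x < u c, Settled q d x s := by
    have h : ∀ᶠ s in atTop, ∀ x ∈ Set.Iio (u c), Settled q d x s :=
      (eventually_all_finite (Set.finite_Iio _)).2 fun x _ => by
        obtain ⟨t, ht⟩ := exists_settled hq x
        exact (eventually_ge_atTop t).mono fun s hs => ht.mono hs
    exact h.exists
  refine ⟨q, fun c => Nat.find (hex c), ComputablePredIn.find
    (p := fun c s => ∀ x < u c, Settled q d x s) ?_ hex, fun c s hs x hx =>
      ((Nat.find_spec (hex c) x hx).mono hs).guess_eq hq⟩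
  exact ComputablePredIn.forall_lt (p := fun p x => Settled q d x p.2)
    ((computablePredIn_settled q d).comp (f := fun z : (ℕ × ℕ) × ℕ => (z.2, z.1.2))
      (Primrec.computableIn (by fun_prop)))
    (hu.comp .fst).computableIn

end Guess

section Construction

variable {d : Code} {c j s t : ℕ}

/-- The finite part of the halting set enumerated by stage `s`. -/
def haltingStage (s : ℕ) : Set ℕ := {k | k ∈ ceStage (ofNat Code k) s}

theorem haltingStage_mono : Monotone haltingStage := fun _ _ h _ hk => ceStage_mono _ h hk

theorem mem_haltingSet_iff {k : ℕ} : k ∈ haltingSet ↔ ∃ s, k ∈ haltingStage s :=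
  mem_ceSet_iff (d := ofNat Code k)

theorem primrecPred_mem_haltingStage {α : Type*} [Primcodable α] {k s : α → ℕ} (hk : Primrec k)
    (hs : Primrec s) : PrimrecPred fun a => k a ∈ haltingStage (s a) :=
  primrecPred_mem_ceStage (by fun_prop) hs hk

/-- The number of elements of column `c` that are not put into the dump set from the start. There
are at most `c + 2` events for column `c`, each dumping at most `c + 1` elements. -/
def columnSize (c : ℕ) : ℕ := (c + 1) * (c + 2) + 1

@[fun_prop]
theorem primrec_columnSize {α : Type*} [Primcodable α] {c : α → ℕ} (hc : Primrec c) :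
    Primrec fun a => columnSize (c a) :=
  primrec_add (Primrec.nat_mul.comp (by fun_prop) (by fun_prop)) (.const 1)

/-- The events for column `c` that have occurred by stage `s`: the event `k ≤ c` is the enumeration
of `k` into the halting set, the event `c + 1` is the enumeration of `c` into `ceSet d`. -/
def events (d : Code) (c s : ℕ) : Set ℕ :=
  {k | k ≤ c ∧ k ∈ haltingStage s ∨ k = c + 1 ∧ c ∈ ceStage d s}

theorem events_mono (d : Code) (c : ℕ) : Monotone (events d c) := fun _ _ h _ =>
  Or.imp (And.imp_right (haltingStage_mono h ·)) (And.imp_right (ceStage_mono d h ·))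

theorem events_subset_Iio (d : Code) (c s : ℕ) : events d c s ⊆ Set.Iio (c + 2) := by
  rintro k (⟨hk, -⟩ | ⟨rfl, -⟩) <;> simp only [Set.mem_Iio] <;> lia

theorem finite_events (d : Code) (c s : ℕ) : (events d c s).Finite :=
  (Set.finite_Iio _).subset (events_subset_Iio d c s)

theorem ncard_events_le (d : Code) (c s : ℕ) : (events d c s).ncard ≤ c + 2 := by
  simpa using Set.ncard_le_ncard (events_subset_Iio d c s) (Set.finite_Iio _)

theorem mem_events_iff_mem_haltingStage {k : ℕ} (hk : k ≤ c) :
    k ∈ events d c s ↔ k ∈ haltingStage s := by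
  simp only [events, Set.mem_ofPred_eq, hk, true_and, or_iff_left_iff_imp]
  lia

theorem succ_mem_events_iff : c + 1 ∈ events d c s ↔ c ∈ ceStage d s := by
  simp [events]

theorem primrecPred_mem_events {α : Type*} [Primcodable α] (d : Code) {c s k : α → ℕ}
    (hc : Primrec c) (hs : Primrec s) (hk : Primrec k) :
    PrimrecPred fun a => k a ∈ events d (c a) (s a) :=
  ((Primrec.nat_le.comp hk hc).and (primrecPred_mem_haltingStage hk hs)).or
    ((Primrec.eq.comp hk (by fun_prop)).and (primrecPred_mem_ceStage (.const d) hs hc))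

theorem events_ne_succ_iff :
    events d c s ≠ events d c (s + 1) ↔
      ∃ k < c + 2, k ∈ events d c (s + 1) ∧ k ∉ events d c s := by
  refine ⟨fun hne => ?_, fun ⟨_, _, hk, hk'⟩ heq => hk' (heq ▸ hk)⟩
  obtain ⟨k, hk, hk'⟩ := Set.exists_of_ssubset ((events_mono d c s.le_succ).ssubset_of_ne hne)
  exact ⟨k, events_subset_Iio d c _ hk, hk, hk'⟩

theorem primrecPred_events_ne_succ (d : Code) :
    PrimrecPred fun p : ℕ × ℕ => events d p.1 p.2 ≠ events d p.1 (p.2 + 1) := by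
  have hnew : PrimrecRel fun (k : ℕ) (p : ℕ × ℕ) =>
      k ∈ events d p.1 (p.2 + 1) ∧ k ∉ events d p.1 p.2 :=
    (primrecPred_mem_events d (by fun_prop) (by fun_prop) (by fun_prop)).and
      (primrecPred_mem_events d (by fun_prop) (by fun_prop) (by fun_prop)).not
  exact (hnew.exists_mem_list.comp (Primrec.list_range.comp
    (g := fun p : ℕ × ℕ => p.1 + 2) (by fun_prop)) .id).of_eq fun p => by
      simp only [List.mem_range, id_eq, events_ne_succ_iff]

/-- The first element of column `c` that the separator computed by the functional `q` from the
oracle `ceSet d'` appears to omit at stage `s`. -/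
noncomputable def firstOmitted (q d' : Code) (c s : ℕ) : Option ℕ :=
  (List.range (columnSize c)).find? fun j => guess q d' (Nat.pair c j) s = some 0

/-- The elements of column `c` that are dumped when an event for that column occurs at stage `s`:
one for each of the first `c + 1` pairs of a functional and an oracle. -/
noncomputable def victims (c s : ℕ) : List ℕ :=
  (List.range (c + 1)).filterMap fun e =>
    firstOmitted (ofNat (Code × Code) e).1 (ofNat (Code × Code) e).2 c s

theorem primrec_victims : Primrec fun p : ℕ × ℕ => victims p.1 p.2 := by
  refine Primrec.listFilterMap (by fun_prop) (primrec_find? (by fun_prop) ?_)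
  exact Primrec.eq.comp (by fun_prop) (.const (some 0))

theorem exists_mem_victims {q d' : Code} (hc : encode (q, d') ≤ c) (hj : j < columnSize c)
    (h : guess q d' (Nat.pair c j) s = some 0) :
    ∃ i ∈ victims c s, i < columnSize c ∧ guess q d' (Nat.pair c i) s = some 0 := by
  have hsome : (firstOmitted q d' c s).isSome :=
    List.find?_isSome.2 ⟨j, List.mem_range.2 hj, decide_eq_true h⟩
  obtain ⟨i, hi⟩ := Option.isSome_iff_exists.1 hsome
  have hmem : i ∈ victims c s :=
    List.mem_filterMap.2 ⟨encode (q, d'), List.mem_range.2 (by lia), by simpa using hi⟩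
  exact ⟨i, hmem, List.mem_range.1 (List.mem_of_find?_eq_some hi),
    by simpa using List.find?_some (p := fun j => guess q d' (Nat.pair c j) s = some 0) hi⟩

theorem length_victims_le (c s : ℕ) : (victims c s).length ≤ c + 1 :=
  (List.length_filterMap_le _ _).trans_eq List.length_range

open Classical in
/-- The elements of column `c` that have been dumped before stage `s`. The column is frozen once
`c` has been enumerated into `ceSet d`. -/
noncomputable def dumped (d : Code) (c : ℕ) : ℕ → List ℕ
  | 0 => []
  | s + 1 =>
    if c ∉ ceStage d s ∧ events d c s ≠ events d c (s + 1) then victims c s ++ dumped d c s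
    else dumped d c s

theorem primrec_dumped (d : Code) : Primrec₂ (dumped d) := by
  classical
  have hproj : Primrec fun p : ℕ × (ℕ × List ℕ) => (p.1, p.2.1) := by fun_prop
  have hstep : Primrec fun p : ℕ × (ℕ × List ℕ) =>
      if p.1 ∉ ceStage d p.2.1 ∧ events d p.1 p.2.1 ≠ events d p.1 (p.2.1 + 1)
      then victims p.1 p.2.1 ++ p.2.2 else p.2.2 :=
    .ite ((primrecPred_mem_ceStage (.const d) (by fun_prop) (by fun_prop)).not.and
        ((primrecPred_events_ne_succ d).comp hproj))
      (Primrec.list_append.comp (primrec_victims.comp hproj) (by fun_prop)) (by fun_prop)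
  refine (Primrec.nat_rec (.const []) hstep.to₂).of_eq fun c s => ?_
  induction s with
  | zero => rfl
  | succ s ih => simp only [dumped, ih]

theorem primrecPred_mem_dumped {α : Type*} [Primcodable α] (d : Code) {c s j : α → ℕ}
    (hc : Primrec c) (hs : Primrec s) (hj : Primrec j) :
    PrimrecPred fun a => j a ∈ dumped d (c a) (s a) :=
  primrecPred_mem_list ((primrec_dumped d).comp hc hs) hj

theorem dumped_eq_of_mem_ceStage (hc : c ∈ ceStage d s) (hst : s ≤ t) :
    dumped d c t = dumped d c s := by
  induction t, hst using Nat.le_induction with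
  | base => rfl
  | succ t hst ih => simp [dumped, ceStage_mono d hst hc, ih]

theorem dumped_subset (d : Code) (c : ℕ) (hst : s ≤ t) : dumped d c s ⊆ dumped d c t := by
  induction t, hst using Nat.le_induction with
  | base => exact List.Subset.refl _
  | succ t _ ih =>
    refine List.Subset.trans ih ?_
    simp only [dumped]
    split_ifs
    · exact List.subset_append_right _ _
    · exact List.Subset.refl _

theorem length_dumped_le (d : Code) (c s : ℕ) :
    (dumped d c s).length ≤ (c + 1) * (events d c s).ncard := by
  induction s with
  | zero => simp [dumped]
  | succ s ih =>
    have hsub := events_mono d c s.le_succ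
    unfold dumped
    split_ifs with h
    · have hlt := Set.ncard_lt_ncard (hsub.ssubset_of_ne h.2) (finite_events d c _)
      rw [List.length_append]
      nlinarith [length_victims_le c s]
    · have hle := Set.ncard_le_ncard hsub (finite_events d c _)
      exact ih.trans (Nat.mul_le_mul_left _ hle)

theorem exists_lt_columnSize_notMem_dumped (d : Code) (c : ℕ) :
    ∃ j < columnSize c, ∀ s, j ∉ dumped d c s := by
  by_contra! h
  have hall : ∀ᶠ s in atTop, ∀ j ∈ Set.Iio (columnSize c), j ∈ dumped d c s :=
    (eventually_all_finite (Set.finite_Iio _)).2 fun j hj => by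
      obtain ⟨s, hs⟩ := h j hj
      exact (eventually_ge_atTop s).mono fun t ht => dumped_subset d c ht hs
  obtain ⟨s, hs⟩ := hall.exists
  have hcard : columnSize c ≤ (dumped d c s).length := by
    have hsub : Finset.range (columnSize c) ⊆ (dumped d c s).toFinset := fun j hj =>
      List.mem_toFinset.2 (hs j (Finset.mem_range.1 hj))
    simpa using (Finset.card_le_card hsub).trans (List.toFinset_card_le _)
  have hbound := (length_dumped_le d c s).trans
    (Nat.mul_le_mul_left (c + 1) (ncard_events_le d c s))
  unfold columnSize at hcard
  lia

end Construction

section SeparatingPair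

variable {d : Code} {c j s t : ℕ} {Z : Set ℕ}

/-- The set `A` of the theorem. The pair `Nat.pair c j` is the element `j` of column `c`. -/
def dumpSet (d : Code) : Set ℕ :=
  {p | columnSize p.unpair.1 ≤ p.unpair.2 ∨ ∃ s, p.unpair.2 ∈ dumped d p.unpair.1 s}

/-- The set `B` of the theorem: the part outside `dumpSet d` of the columns with index in
`ceSet d`. -/
def codeSet (d : Code) : Set ℕ := {p | p.unpair.1 ∈ ceSet d} \ dumpSet d

theorem pair_mem_dumpSet :
    Nat.pair c j ∈ dumpSet d ↔ columnSize c ≤ j ∨ ∃ s, j ∈ dumped d c s := by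
  simp [dumpSet]

theorem pair_mem_codeSet :
    Nat.pair c j ∈ codeSet d ↔ c ∈ ceSet d ∧ Nat.pair c j ∉ dumpSet d := by
  simp [codeSet]

theorem lt_columnSize_of_pair_notMem_dumpSet (h : Nat.pair c j ∉ dumpSet d) :
    j < columnSize c := by
  contrapose! h
  exact pair_mem_dumpSet.2 (.inl h)

theorem pair_notMem_dumpSet_iff (hc : c ∈ ceStage d s) :
    Nat.pair c j ∉ dumpSet d ↔ j < columnSize c ∧ j ∉ dumped d c s := by
  simp only [pair_mem_dumpSet, not_or, not_le, not_exists]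
  refine and_congr_right fun _ => ⟨fun h => h s, fun h t hj => h ?_⟩
  rw [← dumped_eq_of_mem_ceStage hc (le_max_left s t)]
  exact dumped_subset d c (le_max_right s t) hj

theorem exists_pair_notMem_dumpSet (d : Code) (c : ℕ) :
    ∃ j < columnSize c, Nat.pair c j ∉ dumpSet d := by
  obtain ⟨j, hj, hjs⟩ := exists_lt_columnSize_notMem_dumped d c
  exact ⟨j, hj, by simpa [pair_mem_dumpSet, hj] using hjs⟩

theorem isCE_dumpSet (d : Code) : IsCE (dumpSet d) := by
  have h := isCE_of_primrecPred
    (R := fun p s => columnSize p.unpair.1 ≤ p.unpair.2 ∨ p.unpair.2 ∈ dumped d p.unpair.1 s)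
    ((Primrec.nat_le.comp (by fun_prop) (by fun_prop)).or
      (primrecPred_mem_dumped d (by fun_prop) (by fun_prop) (by fun_prop)))
  simp only [exists_or, exists_const] at h
  exact h

theorem primrecPred_lt_columnSize_and_notMem_dumped (d : Code) : PrimrecPred fun p : ℕ × ℕ =>
    p.1.unpair.2 < columnSize p.1.unpair.1 ∧ p.1.unpair.2 ∉ dumped d p.1.unpair.1 p.2 :=
  (Primrec.nat_lt.comp (by fun_prop) (by fun_prop)).and
    (primrecPred_mem_dumped d (by fun_prop) (by fun_prop) (by fun_prop)).not

theorem isCE_codeSet (d : Code) : IsCE (codeSet d) := by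
  have h : codeSet d = {p | ∃ s, p.unpair.1 ∈ ceStage d s ∧
      p.unpair.2 < columnSize p.unpair.1 ∧ p.unpair.2 ∉ dumped d p.unpair.1 s} := by
    ext p
    rw [← Nat.pair_unpair p, pair_mem_codeSet, mem_ceSet_iff, exists_and_right.symm]
    simpa only [Set.mem_ofPred_eq, Nat.unpair_pair] using
      exists_congr fun s => and_congr_right pair_notMem_dumpSet_iff
  rw [h]
  exact isCE_of_primrecPred ((primrecPred_mem_ceStage (.const d) (by fun_prop)
    (by fun_prop)).and (primrecPred_lt_columnSize_and_notMem_dumped d))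

theorem infinite_compl_union (hC : (ceSet d)ᶜ.Infinite) : (dumpSet d ∪ codeSet d)ᶜ.Infinite := by
  choose j _ hj using exists_pair_notMem_dumpSet d
  refine (hC.image (f := fun c => Nat.pair c (j c)) fun c _ c' _ h =>
    (Nat.pair_eq_pair.1 h).1).mono ?_
  rintro _ ⟨c, hc, rfl⟩ (h | h)
  · exact hj c h
  · exact hc (pair_mem_codeSet.1 h).1

theorem exists_le_fst_of_infinite {S : Set ℕ} (hS : S.Infinite) (hSd : Disjoint S (dumpSet d))
    (m : ℕ) : ∃ p ∈ S, m ≤ p.unpair.1 := by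
  by_contra! h
  have hfin : (⋃ c ∈ Set.Iio m, Nat.pair c '' Set.Iio (columnSize c)).Finite :=
    (Set.finite_Iio m).biUnion fun c _ => (Set.finite_Iio _).image _
  refine hS (hfin.subset fun p hp => Set.mem_biUnion (h p hp) ⟨p.unpair.2, ?_, Nat.pair_unpair p⟩)
  exact lt_columnSize_of_pair_notMem_dumpSet
    ((Nat.pair_unpair p).symm ▸ Set.disjoint_left.1 hSd hp)

theorem deg_codeSet (d : Code) : deg (codeSet d) = deg (ceSet d) := by
  classical
  have hcol : ComputableIn {charFun (ceSet d)} fun p : ℕ => p.unpair.1 :=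
    Primrec.computableIn (by fun_prop)
  have hstage (c : ℕ) : ∃ s, c ∈ ceSet d → c ∈ ceStage d s :=
    (eventually_imp_distrib_left.2 eventually_mem_ceStage).exists
  have hfind : ComputableIn {charFun (ceSet d)} fun c => Nat.find (hstage c) :=
    ComputablePredIn.find (p := fun c s => c ∈ ceSet d → c ∈ ceStage d s)
      (((computablePredIn_mem _).comp .fst).imp
        (.of_primrecPred (primrecPred_mem_ceStage (.const d) .snd .fst))) hstage
  apply le_antisymm <;> rw [deg_le_deg_iff]
  · refine (((computablePredIn_mem _).comp hcol).and
      ((ComputablePredIn.of_primrecPred (primrecPred_lt_columnSize_and_notMem_dumped d)).comp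
        (computableIn_pair .id (computableIn_comp hfind hcol)))).of_iff fun p => ?_
    conv_rhs => rw [← Nat.pair_unpair p, pair_mem_codeSet]
    exact and_congr_right fun hp => (pair_notMem_dumpSet_iff (Nat.find_spec (hstage _) hp)).symm
  · refine (ComputablePredIn.exists_lt (p := fun c j => Nat.pair c j ∈ codeSet d)
      ((computablePredIn_mem _).comp (Primrec.computableIn (by fun_prop)))
      (Primrec.computableIn (f := columnSize) (by fun_prop))).of_iff fun c => ?_
    simp only [pair_mem_codeSet]
    refine ⟨fun ⟨_, _, hc, _⟩ => hc, fun hc => ?_⟩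
    obtain ⟨j, hj, hjd⟩ := exists_pair_notMem_dumpSet d c
    exact ⟨j, hj, hc, hjd⟩

theorem events_eq_of_guess_eq {q d' : Code} (hZ : dumpSet d ⊆ Z) (hqc : encode (q, d') ≤ c)
    (hc : c ∉ ceStage d t) (hj : Nat.pair c j ∉ Z)
    (hguess : ∀ s ≥ t, ∀ i < columnSize c,
      guess q d' (Nat.pair c i) s = some (Z.indicator 1 (Nat.pair c i)))
    (hts : t ≤ s) : events d c s = events d c t := by
  induction s, hts using Nat.le_induction with
  | base => rfl
  | succ s hts ih =>
    rw [← ih]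
    by_contra! hne
    have hcs : c ∉ ceStage d s := by rwa [← succ_mem_events_iff, ih, succ_mem_events_iff]
    have hjc := lt_columnSize_of_pair_notMem_dumpSet (fun h => hj (hZ h))
    obtain ⟨i, hi, hic, hi0⟩ := exists_mem_victims (s := s) hqc hjc
      (by simp [hguess s hts j hjc, hj])
    have hdumped : i ∈ dumped d c (s + 1) := by
      simp [dumped, hcs, hne.symm, hi]
    have hiZ : Nat.pair c i ∈ Z := hZ (pair_mem_dumpSet.2 (.inr ⟨_, hdumped⟩))
    simp [hguess s hts i hic, hiZ] at hi0

theorem mem_haltingSet_iff_mem_haltingStage {k : ℕ} (hk : k ≤ c)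
    (h : ∀ s ≥ t, events d c s = events d c t) : k ∈ haltingSet ↔ k ∈ haltingStage t := by
  rw [mem_haltingSet_iff]
  refine ⟨fun ⟨s, hs⟩ => ?_, fun ht => ⟨t, ht⟩⟩
  rw [← mem_events_iff_mem_haltingStage hk, ← h (max s t) (le_max_right s t),
    mem_events_iff_mem_haltingStage hk]
  exact haltingStage_mono (le_max_left s t) hs

theorem exists_column_notMem_ceSet (hZ : dumpSet d ⊆ Z) (hinf : (Zᶜ \ codeSet d).Infinite)
    (m : ℕ) : ∃ p ∉ Z, m ≤ p.unpair.1 ∧ p.unpair.1 ∉ ceSet d := by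
  obtain ⟨p, ⟨hpZ, hpB⟩, hp⟩ := exists_le_fst_of_infinite hinf
    (Set.disjoint_left.2 fun p hp hpd => hp.1 (hZ hpd)) m
  exact ⟨p, hpZ, hp, fun hpC => hpB ⟨hpC, fun hpd => hpZ (hZ hpd)⟩⟩

theorem zeroJump_le_deg_of_haltingStage {P : ℕ → ℕ → Prop} {t : ℕ → ℕ}
    (hP : ComputablePredIn {charFun Z} fun x : ℕ × ℕ => P x.1 x.2)
    (ht : ComputableIn {charFun Z} t) (hex : ∀ k, ∃ p, P k p)
    (hPt : ∀ k p, P k p → (k ∈ haltingSet ↔ k ∈ haltingStage (t p))) : zeroJump ≤ deg Z := by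
  classical
  have hsettle : ComputableIn {charFun Z} fun k => (k, t (Nat.find (hex k))) :=
    computableIn_pair .id (computableIn_comp ht (ComputablePredIn.find hP hex))
  exact deg_le_deg_iff.2 (((ComputablePredIn.of_primrecPred
    (primrecPred_mem_haltingStage .fst .snd)).comp hsettle).of_iff fun k =>
      (hPt k _ (Nat.find_spec (hex k))).symm)

theorem zeroJump_le_deg_of_infinite (hw : IsCEDegree (deg Z)) (hZ : dumpSet d ⊆ Z)
    (hinf : (Zᶜ \ codeSet d).Infinite) : zeroJump ≤ deg Z := by
  obtain ⟨W, hW, hdeg⟩ := hw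
  obtain ⟨d', rfl⟩ := hW.exists_ceSet_eq
  obtain ⟨q, M, hM, hguess⟩ := exists_modulus (f := Z.indicator 1) (d := d')
    (u := fun c => Nat.pair c (columnSize c))
    (by simpa only [charFun_eq_indicator] using
      (show TuringReducible (charFun Z) (charFun (ceSet d')) from hdeg.ge))
    (Primrec.to_comp (by fun_prop))
  have hcol : ComputableIn {charFun Z} fun p : ℕ => p.unpair.1 :=
    Primrec.computableIn (by fun_prop)
  have hMcol : ComputableIn {charFun Z} fun p : ℕ => M p.unpair.1 :=
    computableIn_comp (RecursiveIn.subst hM (by rintro _ rfl; exact hdeg.le)) hcol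
  have hle : PrimrecPred fun x : ℕ × ℕ => max x.1 (encode (q, d')) ≤ x.2.unpair.1 :=
    Primrec.nat_le.comp (Primrec.nat_max.comp .fst (.const _)) (by fun_prop)
  have hstage : PrimrecPred fun x : ℕ × ℕ => x.1 ∉ ceStage d x.2 :=
    (primrecPred_mem_ceStage (.const d) .snd .fst).not
  refine zeroJump_le_deg_of_haltingStage (P := fun k p => p ∉ Z ∧
      max k (encode (q, d')) ≤ p.unpair.1 ∧ p.unpair.1 ∉ ceStage d (M p.unpair.1))
    (((computablePredIn_mem Z).not.comp .snd).and ((ComputablePredIn.of_primrecPred hle).and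
      (((ComputablePredIn.of_primrecPred hstage).comp (computableIn_pair hcol hMcol)).comp .snd)))
    hMcol (fun k => ?_) fun k p ⟨hpZ, hmax, hpC⟩ => ?_
  · obtain ⟨p, hpZ, hmax, hpC⟩ := exists_column_notMem_ceSet hZ hinf (max k (encode (q, d')))
    exact ⟨p, hpZ, hmax, fun h => hpC (ceStage_subset d _ h)⟩
  · obtain ⟨hk, hqd⟩ := max_le_iff.1 hmax
    exact mem_haltingSet_iff_mem_haltingStage hk fun s hs => events_eq_of_guess_eq hZ hqd hpC
      (by rwa [Nat.pair_unpair])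
      (fun s hs i hi => hguess _ s hs _ (Nat.pair_lt_pair_right _ hi)) hs

end SeparatingPair

section Spectrum

variable {d : Code} {X Z : Set ℕ}

theorem IsCE.deg_le_zeroJump (hX : IsCE X) : deg X ≤ zeroJump := by
  obtain ⟨d, rfl⟩ := hX.exists_ceSet_eq
  have hs : Primrec fun x => encode (Code.comp d (Code.const x)) :=
    Primrec.encode.comp (Code.primrec₂_comp.comp (.const d) Code.primrec_const)
  refine deg_le_deg_iff.2
    (((computablePredIn_mem haltingSet).comp hs.computableIn).of_iff fun x => ?_)
  have heval : eval (.comp d (.const x)) (encode (Code.comp d (Code.const x))) = eval d x :=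
    (congrArg (Part.bind · (eval d)) (Code.eval_const x _)).trans (Part.bind_some _ _)
  simp [haltingSet, ceSet, heval]

theorem IsCEDegree.le_zeroJump {w : TuringDegree} (hw : IsCEDegree w) : w ≤ zeroJump := by
  obtain ⟨W, hW, rfl⟩ := hw
  exact hW.deg_le_zeroJump

theorem IsCEDegree.exists_infinite_compl_ceSet {w : TuringDegree} (hw : IsCEDegree w) :
    ∃ d, (ceSet d)ᶜ.Infinite ∧ deg (ceSet d) = w := by
  obtain ⟨W, hW, rfl⟩ := hw
  by_cases hfin : Wᶜ.Finite
  · obtain ⟨d, hd⟩ := IsCE.exists_ceSet_eq (X := ∅) (Partrec.none (α := ℕ) (σ := ℕ)).dom_re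
    refine ⟨d, by simp [hd, Set.infinite_univ], ?_⟩
    rw [hd, ← deg_compl W]
    exact deg_eq_deg_of_finite_symmDiff (by simpa [symmDiff_comm, ← Set.bot_eq_empty] using hfin)
  · obtain ⟨d, rfl⟩ := hW.exists_ceSet_eq
    exact ⟨d, hfin, rfl⟩

theorem deg_eq_deg_ceSet_of_finite (hZ : Z ∩ codeSet d = ∅) (hfin : (Zᶜ \ codeSet d).Finite) :
    deg Z = deg (ceSet d) := by
  rw [← deg_codeSet d, ← deg_compl Z]
  refine deg_eq_deg_of_finite_symmDiff ?_
  have hsub : codeSet d ⊆ Zᶜ := (Set.disjoint_iff_inter_eq_empty.2 hZ).subset_compl_left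
  rwa [Set.symmDiff_def, Set.sdiff_eq_empty.2 hsub, Set.union_empty]

theorem deg_dumpSet (hC : (ceSet d)ᶜ.Infinite) : deg (dumpSet d) = zeroJump := by
  refine le_antisymm (isCE_dumpSet d).deg_le_zeroJump
    (zeroJump_le_deg_of_infinite ⟨_, isCE_dumpSet d, rfl⟩ subset_rfl ?_)
  simpa only [Set.compl_union, Set.sdiff_eq] using infinite_compl_union hC

theorem deg_compl_codeSet (d : Code) : deg (codeSet d)ᶜ = deg (ceSet d) :=
  (deg_compl _).trans (deg_codeSet d)

theorem dumpSet_inter_codeSet (d : Code) : dumpSet d ∩ codeSet d = ∅ :=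
  Set.inter_sdiff_self _ _

theorem spectrum_separatingClass (hC : (ceSet d)ᶜ.Infinite) :
    spectrum (separatingClass (dumpSet d) (codeSet d)) = {deg (ceSet d), zeroJump} := by
  have hdisj := dumpSet_inter_codeSet d
  ext w
  constructor
  · rintro ⟨hw, Z, ⟨hAZ, hZB⟩, rfl⟩
    rcases (Zᶜ \ codeSet d).finite_or_infinite with hfin | hinf
    · exact .inl (deg_eq_deg_ceSet_of_finite hZB hfin)
    · exact .inr (hw.le_zeroJump.antisymm (zeroJump_le_deg_of_infinite hw hAZ hinf))
  · rintro (rfl | rfl)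
    · exact ⟨⟨_, isCE_codeSet d, deg_codeSet d⟩, _, ⟨(Set.disjoint_iff_inter_eq_empty.2
        hdisj).subset_compl_right, Set.compl_inter_self _⟩, deg_compl_codeSet d⟩
    · exact ⟨⟨_, isCE_dumpSet d, deg_dumpSet hC⟩, _, ⟨subset_rfl, hdisj⟩, deg_dumpSet hC⟩

end Spectrum

end SeparatingSpectra

theorem mainTheorem2 (c : TuringDegree) (hc : SeparatingSpectra.IsCEDegree c) :
    ∃ A B : Set ℕ, SeparatingSpectra.IsCE A ∧ SeparatingSpectra.IsCE B ∧ A ∩ B = ∅ ∧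
      (A ∪ B)ᶜ.Infinite ∧
      SeparatingSpectra.spectrum (SeparatingSpectra.separatingClass A B) =
        {c, SeparatingSpectra.zeroJump} ∧
      SeparatingSpectra.deg A = SeparatingSpectra.zeroJump ∧
      SeparatingSpectra.deg Bᶜ = c := by
  obtain ⟨d, hC, rfl⟩ := hc.exists_infinite_compl_ceSet
  exact ⟨SeparatingSpectra.dumpSet d, SeparatingSpectra.codeSet d,
    SeparatingSpectra.isCE_dumpSet d, SeparatingSpectra.isCE_codeSet d,
    SeparatingSpectra.dumpSet_inter_codeSet d, SeparatingSpectra.infinite_compl_union hC,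
    SeparatingSpectra.spectrum_separatingClass hC, SeparatingSpectra.deg_dumpSet hC,
    SeparatingSpectra.deg_compl_codeSet d⟩
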